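/- Let $D\ge 2$. For a real $D\times D$ matrix $M=(M_{ij})$ let $|M|=\big(\sum_{i,j}M_{ij}^2\big)^{1/2}$ be its Hilbert--Schmidt norm, and for $0<\varepsilon\le 1$ call a $C^1$ diffeomorphism $\Phi$ of $\mathbb R^D$ onto itself (bijective, with $C^1$ inverse) $\varepsilon$-distorted if its Jacobian matrix satisfies $$(1-\varepsilon)I\le \Phi'(x)^{T}\Phi'(x)\le(1+\varepsilon)I\qquad\text{for all }x\in\mathbb R^D,$$ in the sense of symmetric matrices. Then there is a constant $C>0$, depending only on $D$, such that for every $0<\varepsilon\le 1$, every $\varepsilon$-distorted diffeomorphism $\Phi:\mathbb R^D\to\mathbb R^D$ and every open ball $B\subset\mathbb R^D$ (of positive radius), there exists an orthogonal matrix $T_B\in O(D)$ with $$\left(\frac{1}{\operatorname{vol} B}\int_B|\Phi'(x)-T_B|^4\,dx\right)^{1/4}\le C\,\varepsilon^{1/2}.$$ -/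

import Mathlib

open MeasureTheory
open scoped Manifold ContDiff

/-- Hilbert-Schmidt norm `|M| = (∑ᵢⱼ Mᵢⱼ²)^(1/2)` of a real `D × D` matrix. -/
noncomputable def hsNorm {D : ℕ} (M : Matrix (Fin D) (Fin D) ℝ) : ℝ :=
  Real.sqrt (∑ i, ∑ j, M i j ^ 2)

/-- The Jacobian matrix `Φ'(x)`, whose `(i, j)` entry is `∂Φᵢ/∂xⱼ (x)`. -/
noncomputable def jacobianMatrix {D : ℕ}
    (Φ : EuclideanSpace ℝ (Fin D) → EuclideanSpace ℝ (Fin D))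
    (x : EuclideanSpace ℝ (Fin D)) : Matrix (Fin D) (Fin D) ℝ :=
  Matrix.of fun i j => (fderiv ℝ Φ x (EuclideanSpace.single j 1)) i

/-- A diffeomorphism `Φ` of `ℝᴰ` onto itself (of class `C¹`, with `C¹` inverse) is `ε`-distorted
if `(1 - ε) I ≤ Φ'(x)ᵀ Φ'(x) ≤ (1 + ε) I` at every `x`, as symmetric matrices. -/
def IsDistorted {D : ℕ} (ε : ℝ)
    (Φ : Diffeomorph 𝓘(ℝ, EuclideanSpace ℝ (Fin D)) 𝓘(ℝ, EuclideanSpace ℝ (Fin D))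
      (EuclideanSpace ℝ (Fin D)) (EuclideanSpace ℝ (Fin D)) 1) : Prop :=
  ∀ x : EuclideanSpace ℝ (Fin D),
    ((jacobianMatrix Φ x).transpose * jacobianMatrix Φ x
        - (1 - ε) • (1 : Matrix (Fin D) (Fin D) ℝ)).PosSemidef ∧
    ((1 + ε) • (1 : Matrix (Fin D) (Fin D) ℝ)
        - (jacobianMatrix Φ x).transpose * jacobianMatrix Φ x).PosSemidef

/-! The proof bounds the mean-square oscillation of `Φ'` and then upgrades it to fourth powers.

Mean square: for `ε < 1`, derivative bounds for `Φ` and its inverse show that `Φ` preserves squared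
distances up to relative error `ε`, hence by polarization inner products of displacements. Fix a
unit vector `e` and let `a` be the difference quotient of `Φ` from `z` to `z + r • e`. The average
of `Φ' e` along a nearby parallel segment of length `r` has inner product at least `1 - 13ε` with
`a`, while `Φ' e` and `a` have squared length at most `1 + ε`; expanding the square gives
mean-square distance `O(ε)`. Fubini turns segments into balls. Collecting the columns gives a matrix
that is close to `Φ'` at some point of the ball, hence close to the orthogonal polar factor there
(`IsDistorted.exists_setIntegral_hsNorm_sq_le`).

Fourth powers: these bounds hold on every ball, so a John-Nirenberg argument applies
(`exists_setIntegral_pow_four_le`). A stopping time and a Vitali covering turn a fourth-moment bound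
`A`, uniform over balls, into `A / 2 + O(κ²)`; boundedness of `Φ'` starts the iteration, whose limit
no longer depends on the initial bound. With `κ` of order `ε`, the fourth root is of order
`ε^(1/2)`. -/

section Oscillation

open Metric Set Filter Topology

/-! ### Elementary inequalities and summation over a covering. -/

lemma norm_sub_sq_le_two_mul {F : Type*} [NormedAddCommGroup F] (a b c : F) :
    ‖a - b‖ ^ 2 ≤ 2 * ‖c - a‖ ^ 2 + 2 * ‖c - b‖ ^ 2 := by
  have h : ‖a - b‖ ≤ ‖c - a‖ + ‖c - b‖ := by
    have := norm_sub_le (c - b) (c - a)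
    rw [show c - b - (c - a) = a - b by abel] at this
    linarith
  nlinarith [sq_nonneg (‖c - a‖ - ‖c - b‖), norm_nonneg (a - b)]

lemma norm_sub_pow_four_le {F : Type*} [NormedAddCommGroup F] (a b c : F) :
    ‖a - b‖ ^ 4 ≤ 8 * ‖c - a‖ ^ 4 + 8 * ‖c - b‖ ^ 4 := by
  have h := norm_sub_sq_le_two_mul a b c
  nlinarith [sq_nonneg (‖c - a‖ ^ 2 - ‖c - b‖ ^ 2), sq_nonneg ‖a - b‖]

lemma Continuous.norm_sub_const_pow {E F : Type*} [TopologicalSpace E] [NormedAddCommGroup F]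
    {f : E → F} (hf : Continuous f) (a : F) (k : ℕ) : Continuous fun x => ‖f x - a‖ ^ k := by
  fun_prop

/-- Constants that both approximate `f` in mean square on a set are close to each other. -/
lemma norm_sub_sq_le_of_setIntegral_le {E F : Type*} [MeasurableSpace E] [NormedAddCommGroup F]
    {μ : Measure E} {f : E → F} {S : Set E} (hS : 0 < μ.real S) {a b : F}
    {p q : ℝ} (hia : IntegrableOn (fun x => ‖f x - a‖ ^ 2) S μ)
    (hib : IntegrableOn (fun x => ‖f x - b‖ ^ 2) S μ)
    (ha : ∫ x in S, ‖f x - a‖ ^ 2 ∂μ ≤ p * μ.real S)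
    (hb : ∫ x in S, ‖f x - b‖ ^ 2 ∂μ ≤ q * μ.real S) :
    ‖a - b‖ ^ 2 ≤ 2 * p + 2 * q := by
  have hfin : μ S ≠ ⊤ := fun h => by simp [Measure.real, h] at hS
  have h : ∫ _x in S, ‖a - b‖ ^ 2 ∂μ
      ≤ ∫ x in S, (2 * ‖f x - a‖ ^ 2 + 2 * ‖f x - b‖ ^ 2) ∂μ :=
    integral_mono (integrableOn_const hfin)
      ((hia.const_mul 2).add (hib.const_mul 2)) fun x => norm_sub_sq_le_two_mul a b (f x)
  rw [integral_add (hia.const_mul 2) (hib.const_mul 2), integral_const_mul, integral_const_mul,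
    setIntegral_const, smul_eq_mul] at h
  have : μ.real S * ‖a - b‖ ^ 2 ≤ μ.real S * (2 * p + 2 * q) := by linarith
  exact le_of_mul_le_mul_left this hS

/-- Summation over a countable disjoint family: if on each `B i` the integral of `G` controls that
of `H` over the enlarged set `B' i`, then it does so globally. -/
lemma setIntegral_le_of_countable_cover {α ι : Type*} [MeasurableSpace α] {μ : Measure α}
    {u : Set ι} (hu : u.Countable)
    {B B' : ι → Set α} {A S : Set α} {H G : α → ℝ} {q : ℝ} (hq : 0 ≤ q)
    (hH : ∀ x, 0 ≤ H x) (hG : ∀ x, 0 ≤ G x) (hBm : ∀ i ∈ u, MeasurableSet (B i))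
    (hdisj : u.PairwiseDisjoint B) (hBS : ∀ i ∈ u, B i ⊆ S) (hA : A ⊆ ⋃ i ∈ u, B' i)
    (hHi : ∀ i ∈ u, IntegrableOn H (B' i) μ) (hHA : IntegrableOn H A μ) (hGS : IntegrableOn G S μ)
    (h : ∀ i ∈ u, ∫ x in B' i, H x ∂μ ≤ q * ∫ x in B i, G x ∂μ) :
    ∫ x in A, H x ∂μ ≤ q * ∫ x in S, G x ∂μ := by
  have := hu.to_subtype
  -- In `ENNReal` the overlapping cover by the `B' i` needs only subadditivity, with no summability
  -- to check.
  have key : ENNReal.ofReal (∫ x in A, H x ∂μ) ≤ ENNReal.ofReal (q * ∫ x in S, G x ∂μ) := by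
    rw [ENNReal.ofReal_mul hq, ofReal_integral_eq_lintegral_ofReal hHA (ae_of_all _ hH),
      ofReal_integral_eq_lintegral_ofReal hGS (ae_of_all _ hG)]
    calc ∫⁻ x in A, ENNReal.ofReal (H x) ∂μ
        ≤ ∫⁻ x in ⋃ i : u, B' i, ENNReal.ofReal (H x) ∂μ :=
          lintegral_mono_set (by rwa [← biUnion_eq_iUnion u fun i _ => B' i])
      _ ≤ ∑' i : u, ∫⁻ x in B' i, ENNReal.ofReal (H x) ∂μ := lintegral_iUnion_le _ _
      _ ≤ ∑' i : u, ENNReal.ofReal q * ∫⁻ x in B i, ENNReal.ofReal (G x) ∂μ := by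
          refine ENNReal.tsum_le_tsum fun i => ?_
          rw [← ofReal_integral_eq_lintegral_ofReal (hHi i i.2) (ae_of_all _ hH),
            ← ofReal_integral_eq_lintegral_ofReal (hGS.mono_set (hBS i i.2)) (ae_of_all _ hG),
            ← ENNReal.ofReal_mul hq]
          exact ENNReal.ofReal_le_ofReal (h i i.2)
      _ = ENNReal.ofReal q * ∫⁻ x in ⋃ i : u, B i, ENNReal.ofReal (G x) ∂μ := by
          rw [ENNReal.tsum_mul_left, lintegral_iUnion (s := fun i : u => B i)
            (fun i => hBm i i.2) fun i j hij => hdisj i.2 j.2 (Subtype.coe_injective.ne hij)]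
      _ ≤ ENNReal.ofReal q * ∫⁻ x in S, ENNReal.ofReal (G x) ∂μ :=
          mul_le_mul_right (lintegral_mono_set (iUnion_subset fun i : u => hBS i i.2)) _
  exact (ENNReal.ofReal_le_ofReal_iff
    (mul_nonneg hq (integral_nonneg hG))).1 key

/-! ### From mean-square to fourth-power oscillation. -/

variable {E F : Type*} [NormedAddCommGroup E] [NormedSpace ℝ E] [FiniteDimensional ℝ E]
  [MeasurableSpace E] [BorelSpace E] [NormedAddCommGroup F]
  {μ : Measure E} [μ.IsAddHaarMeasure]

lemma Continuous.integrableOn_ball {f : E → ℝ} (hf : Continuous f) (z : E) (r : ℝ) :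
    IntegrableOn f (ball z r) μ := by
  have := FiniteDimensional.proper ℝ E
  exact (hf.continuousOn.integrableOn_compact (isCompact_closedBall z r)).mono_set
    ball_subset_closedBall

omit [BorelSpace E] in
lemma measureReal_ball_pos (z : E) {r : ℝ} (hr : 0 < r) : 0 < μ.real (ball z r) :=
  ENNReal.toReal_pos (measure_ball_pos μ z hr).ne' measure_ball_lt_top.ne

lemma measureReal_ball_mul (x z : E) {c : ℝ} (hc : 0 < c) (r : ℝ) :
    μ.real (ball x (c * r)) = c ^ Module.finrank ℝ E * μ.real (ball z r) := by
  rw [Measure.real, Measure.addHaar_ball_mul_of_pos μ x hc r, ENNReal.toReal_mul,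
    ENNReal.toReal_ofReal (by positivity), ← Measure.addHaar_ball_center μ z r]
  rfl

variable {f : E → F} {T : E → ℝ → F} {κ : ℝ}

/-- Both constants approximate `f` on the smaller ball; restricting the larger ball's bound to it
costs the volume ratio, at most `c ^ finrank`. -/
lemma norm_sub_sq_le_of_ball_subset (hf : Continuous f) (hκ : 0 ≤ κ)
    (hT : ∀ z r, 0 < r → ∫ x in ball z r, ‖f x - T z r‖ ^ 2 ∂μ ≤ κ * μ.real (ball z r))
    {x z : E} {s r c : ℝ} (hs : 0 < s) (hc : 1 ≤ c) (hr : r ≤ c * s) (h : ball x s ⊆ ball z r) :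
    ‖T x s - T z r‖ ^ 2 ≤ 2 * (1 + c ^ Module.finrank ℝ E) * κ := by
  have hr0 : 0 < r := pos_of_mem_ball (h (mem_ball_self hs))
  have hV := measureReal_ball_pos (μ := μ) x hs
  have hle : μ.real (ball z r) ≤ c ^ Module.finrank ℝ E * μ.real (ball x s) := by
    rw [← measureReal_ball_mul z x (by linarith) s]
    exact measureReal_mono (ball_subset_ball hr) measure_ball_lt_top.ne
  have h2 : ∫ y in ball x s, ‖f y - T z r‖ ^ 2 ∂μ
      ≤ (c ^ Module.finrank ℝ E * κ) * μ.real (ball x s) :=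
    calc _ ≤ ∫ y in ball z r, ‖f y - T z r‖ ^ 2 ∂μ :=
          setIntegral_mono_set ((hf.norm_sub_const_pow _ 2).integrableOn_ball z r)
            (ae_of_all _ fun y => by positivity) h.eventuallyLE
      _ ≤ κ * μ.real (ball z r) := hT z r hr0
      _ ≤ κ * (c ^ Module.finrank ℝ E * μ.real (ball x s)) := by gcongr
      _ = _ := by ring
  have := norm_sub_sq_le_of_setIntegral_le hV
    ((hf.norm_sub_const_pow (T x s) 2).integrableOn_ball x s)
    ((hf.norm_sub_const_pow (T z r) 2).integrableOn_ball x s) (hT x s hs) h2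
  linarith

/-- On small balls around `x` the approximating constants are close to `f x`. -/
lemma exists_norm_sub_sq_le_of_small_ball (hf : Continuous f) (hκ : 0 < κ)
    (hT : ∀ z r, 0 < r → ∫ x in ball z r, ‖f x - T z r‖ ^ 2 ∂μ ≤ κ * μ.real (ball z r)) (x : E) :
    ∃ δ > 0, ∀ s, 0 < s → s ≤ δ → ‖f x - T x s‖ ^ 2 ≤ 4 * κ := by
  obtain ⟨δ, hδ, hx⟩ := Metric.continuousAt_iff.1 (hf.continuousAt (x := x)) (Real.sqrt κ)
    (Real.sqrt_pos.2 hκ)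
  refine ⟨δ, hδ, fun s hs hsδ => ?_⟩
  have h1 : ∫ y in ball x s, ‖f y - f x‖ ^ 2 ∂μ ≤ κ * μ.real (ball x s) := by
    have : ∫ y in ball x s, ‖f y - f x‖ ^ 2 ∂μ ≤ ∫ _y in ball x s, κ ∂μ := by
      refine setIntegral_mono_on ((hf.norm_sub_const_pow (f x) 2).integrableOn_ball x s)
        (integrableOn_const measure_ball_lt_top.ne) measurableSet_ball fun y hy => ?_
      have := hx ((mem_ball.1 hy).trans_le hsδ)
      rw [dist_eq_norm] at this
      calc ‖f y - f x‖ ^ 2 ≤ Real.sqrt κ ^ 2 := by gcongr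
        _ = κ := Real.sq_sqrt hκ.le
    rwa [setIntegral_const, smul_eq_mul, mul_comm] at this
  have := norm_sub_sq_le_of_setIntegral_le (measureReal_ball_pos (μ := μ) x hs)
    ((hf.norm_sub_const_pow (f x) 2).integrableOn_ball x s)
    ((hf.norm_sub_const_pow (T x s) 2).integrableOn_ball x s) h1 (hT x s hs)
  linarith

/-- Stopping-time selection of a ball around a point where `f` is far from `T z r`. -/
lemma exists_stopping_radius (hf : Continuous f) (hκ : 0 < κ)
    (hT : ∀ z r, 0 < r → ∫ x in ball z r, ‖f x - T z r‖ ^ 2 ∂μ ≤ κ * μ.real (ball z r))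
    {σ lam : ℝ} (hσ0 : 0 ≤ σ) (hσ : 2 * (1 + 6 ^ Module.finrank ℝ E) * κ ≤ σ ^ 2)
    (hlam : 2 * σ ≤ lam) {z x : E} {r : ℝ} (hr : 0 < r) (hx : x ∈ ball z r)
    (hfx : 2 * lam < ‖f x - T z r‖) :
    ∃ s, 0 < s ∧ s ≤ r / 2 ∧ lam < ‖T x s - T z r‖ ∧ ‖T x (6 * s) - T z r‖ ≤ 2 * lam := by
  have hcmp : ∀ {y w : E} {s t : ℝ}, 0 < s → t ≤ 6 * s → ball y s ⊆ ball w t →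
      ‖T y s - T w t‖ ≤ σ := fun hs ht hsub =>
    abs_le_of_sq_le_sq' ((norm_sub_sq_le_of_ball_subset hf hκ.le hT hs (by norm_num) ht hsub).trans
      hσ) hσ0 |>.2
  have h1 : (1 : ℝ) ≤ 6 ^ Module.finrank ℝ E := one_le_pow₀ (by norm_num)
  obtain ⟨δ, hδ, hsmall⟩ := exists_norm_sub_sq_le_of_small_ball hf hκ hT x
  obtain ⟨N, hN⟩ : ∃ N : ℕ, r * (1 / 2) ^ N < δ := by
    obtain ⟨N, hN⟩ := exists_pow_lt_of_lt_one (div_pos hδ hr) (by norm_num : (1 / 2 : ℝ) < 1)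
    exact ⟨N, by rwa [lt_div_iff₀ hr, mul_comm] at hN⟩
  -- At a tiny radius `T x` is within `σ` of `f x`, which is more than `2 * lam` away from `T z r`.
  -- The stopping radius is the first dyadic one whose constant is farther than `lam`.
  have hex : ∃ n : ℕ, lam < ‖T x (r * (1 / 2) ^ n) - T z r‖ := by
    refine ⟨N, ?_⟩
    have h4 : ‖f x - T x (r * (1 / 2) ^ N)‖ ≤ σ :=
      abs_le_of_sq_le_sq' ((hsmall _ (by positivity) hN.le).trans (by nlinarith)) hσ0 |>.2
    have := norm_sub_le_norm_sub_add_norm_sub (f x) (T x (r * (1 / 2) ^ N)) (T z r)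
    linarith
  classical
  -- Two comparisons through `ball z (2 * r)` cost `2 * σ`, so stopping does not occur at `n = 0`
  -- and a preceding radius exists.
  have h0 : ‖T x r - T z r‖ ≤ lam := by
    have ha := hcmp (y := x) (w := z) (t := 2 * r) hr (by linarith)
      (ball_subset_ball' (by linarith [mem_ball.1 hx]))
    have hb := hcmp (y := z) (w := z) (t := 2 * r) hr (by linarith)
      (ball_subset_ball (by linarith))
    have := norm_sub_le_norm_sub_add_norm_sub (T x r) (T z (2 * r)) (T z r)
    rw [norm_sub_rev (T z (2 * r))] at this
    linarith
  have hn := Nat.find_spec hex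
  have hmin := fun m => Nat.find_min hex (m := m)
  set n := Nat.find hex
  obtain ⟨k, hk⟩ : ∃ k, n = k + 1 := Nat.exists_eq_succ_of_ne_zero fun h => by
    rw [h, pow_zero, mul_one] at hn
    linarith
  have hprev := not_lt.1 (hmin k (by omega))
  have hpk : (1 / 2 : ℝ) ^ k ≤ 1 := pow_le_one₀ (by norm_num) (by norm_num)
  rw [hk] at hn
  have hs2 : r * (1 / 2) ^ k = 2 * (r * (1 / 2) ^ (k + 1)) := by ring
  have hs : 0 < r * (1 / 2 : ℝ) ^ (k + 1) := by positivity
  refine ⟨r * (1 / 2) ^ (k + 1), hs, by nlinarith, hn, ?_⟩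
  -- The preceding radius is twice the stopping radius `s` and its constant is within `lam`;
  -- enlarging to `6 * s` adds at most `σ`.
  have hc := hcmp (y := x) (w := x) (s := r * (1 / 2) ^ k) (t := 6 * (r * (1 / 2) ^ (k + 1)))
    (by positivity) (by linarith) (ball_subset_ball (by linarith))
  have := norm_sub_le_norm_sub_add_norm_sub (T x (6 * (r * (1 / 2) ^ (k + 1))))
    (T x (r * (1 / 2) ^ k)) (T z r)
  rw [norm_sub_rev (T x (6 * (r * (1 / 2) ^ (k + 1)))) (T x (r * (1 / 2) ^ k))] at this
  linarith

/-- Off the set `X` where `f` is farther than `2 * lam` from `T z r`, the integrand is at most `16 *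
lam ^ 4`. On `X`, stopping balls have total volume controlled by a mean-square integral (Chebyshev),
and `A` is applied only on their enlargements. Large `lam ^ 2 / σ ^ 2` makes that volume small
enough to reduce `A` to `A / 2`. -/
lemma setIntegral_pow_four_improvement (hf : Continuous f) (hκ : 0 < κ)
    (hT : ∀ z r, 0 < r → ∫ x in ball z r, ‖f x - T z r‖ ^ 2 ∂μ ≤ κ * μ.real (ball z r))
    {σ lam A : ℝ} (hσ0 : 0 ≤ σ) (hσ : 2 * (1 + 6 ^ Module.finrank ℝ E) * κ ≤ σ ^ 2)
    (hlam : 256 * 12 ^ Module.finrank ℝ E * σ ^ 2 ≤ lam ^ 2) (hlam0 : 0 < lam) (hA0 : 0 ≤ A)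
    (hA : ∀ z r, 0 < r → ∫ x in ball z r, ‖f x - T z r‖ ^ 4 ∂μ ≤ A * μ.real (ball z r))
    (z : E) {r : ℝ} (hr : 0 < r) :
    ∫ x in ball z r, ‖f x - T z r‖ ^ 4 ∂μ ≤ (A / 2 + 24 * lam ^ 4) * μ.real (ball z r) := by
  have h1 : (1 : ℝ) ≤ 6 ^ Module.finrank ℝ E := one_le_pow₀ (by norm_num)
  have h12 : (1 : ℝ) ≤ 12 ^ Module.finrank ℝ E := one_le_pow₀ (by norm_num)
  have hlamσ : 2 * σ ≤ lam := abs_le_of_sq_le_sq' (by nlinarith [sq_nonneg σ]) hlam0.le |>.2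
  have hκσ : 4 * κ ≤ σ ^ 2 := by nlinarith
  have hI : ∀ (a : F) (k : ℕ) (w : E) (t : ℝ), IntegrableOn (fun x => ‖f x - a‖ ^ k) (ball w t) μ :=
    fun a k w t => (hf.norm_sub_const_pow a k).integrableOn_ball w t
  set a := T z r with ha
  set X : Set E := {x | x ∈ ball z r ∧ 2 * lam < ‖f x - a‖} with hX
  have hXm : MeasurableSet X :=
    measurableSet_ball.inter (isOpen_lt continuous_const (hf.sub continuous_const).norm).measurableSet
  have hXsub : X ⊆ ball z r := fun x hx => hx.1
  have hradius : ∀ x : E, x ∈ X → ∃ s, 0 < s ∧ s ≤ r / 2 ∧ lam < ‖T x s - a‖ ∧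
      ‖T x (6 * s) - a‖ ≤ 2 * lam := fun x hx =>
    exists_stopping_radius hf hκ hT hσ0 hσ hlamσ hr hx.1 hx.2
  choose! s hs0 hsr hsfar hsnear using hradius
  -- Vitali's factor 5 for closed balls is absorbed by open balls of factor 6, the enlargement for
  -- which the stopping radius was controlled.
  obtain ⟨u, huX, hdisj, hcov⟩ := Vitali.exists_disjoint_subfamily_covering_enlargement_closedBall
    X id s (r / 2) hsr 5 (by norm_num)
  have hdisj' : u.PairwiseDisjoint fun x => ball x (s x) :=
    hdisj.mono fun x => ball_subset_closedBall
  have hucount : u.Countable := hdisj'.countable_of_isOpen (fun _ _ => isOpen_ball)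
    fun x hx => ⟨x, mem_ball_self (hs0 x (huX hx))⟩
  set q := (8 * A + 128 * lam ^ 4) * 6 ^ Module.finrank ℝ E * (4 / lam ^ 2) with hq
  have hq0 : 0 ≤ q := by positivity
  have hbig : ∫ x in X, ‖f x - a‖ ^ 4 ∂μ ≤ q * ∫ x in ball z (2 * r), ‖f x - a‖ ^ 2 ∂μ := by
    refine setIntegral_le_of_countable_cover hucount (B := fun x => ball x (s x))
      (B' := fun x => ball x (6 * s x)) hq0 (fun x => by positivity) (fun x => by positivity)
      (fun _ _ => measurableSet_ball) hdisj' (fun x hx => ?_) (fun x hx => ?_)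
      (fun x _ => hI a 4 x _) ((hI a 4 z r).mono_set hXsub) (hI a 2 z _) fun x hx => ?_
    · exact ball_subset_ball' (by linarith [mem_ball.1 (hXsub (huX hx)), hsr x (huX hx)])
    · obtain ⟨b, hb, hxb⟩ := hcov x hx
      have hsb := hs0 b (huX hb)
      exact mem_biUnion hb (closedBall_subset_ball (by linarith)
        (hxb (mem_closedBall_self (hs0 x hx).le)))
    · have hsx := hs0 x (huX hx)
      have hV : 0 < μ.real (ball x (s x)) := measureReal_ball_pos x hsx
      have hfar : μ.real (ball x (s x)) ≤ 4 / lam ^ 2 * ∫ y in ball x (s x), ‖f y - a‖ ^ 2 ∂μ := by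
        have := norm_sub_sq_le_of_setIntegral_le hV (hI (T x (s x)) 2 x (s x)) (hI a 2 x (s x))
          (hT x (s x) hsx)
          (q := (∫ y in ball x (s x), ‖f y - a‖ ^ 2 ∂μ) / μ.real (ball x (s x)))
          (by rw [div_mul_cancel₀ _ hV.ne'])
        have hl : lam ^ 2 < ‖T x (s x) - a‖ ^ 2 := by
          have := hsfar x (huX hx); gcongr
        have h3 : lam ^ 2 / 4 ≤
            (∫ y in ball x (s x), ‖f y - a‖ ^ 2 ∂μ) / μ.real (ball x (s x)) := by nlinarith
        rw [le_div_iff₀ hV] at h3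
        rw [div_mul_eq_mul_div, le_div_iff₀ (by positivity)]
        linarith
      have hnear : ∫ y in ball x (6 * s x), ‖f y - a‖ ^ 4 ∂μ
          ≤ (8 * A + 128 * lam ^ 4) * 6 ^ Module.finrank ℝ E * μ.real (ball x (s x)) := by
        have hle : ∫ y in ball x (6 * s x), ‖f y - a‖ ^ 4 ∂μ ≤
            ∫ y in ball x (6 * s x), (8 * ‖f y - T x (6 * s x)‖ ^ 4 + 128 * lam ^ 4) ∂μ := by
          refine integral_mono (hI a 4 x _)
            (((hI _ 4 x _).const_mul 8).add (integrableOn_const measure_ball_lt_top.ne))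
            fun y => ?_
          have h5 := norm_sub_pow_four_le (f y) a (T x (6 * s x))
          rw [norm_sub_rev _ (f y)] at h5
          have h6 : ‖T x (6 * s x) - a‖ ^ 4 ≤ (2 * lam) ^ 4 := by
            have := hsnear x (huX hx); gcongr
          show ‖f y - a‖ ^ 4 ≤ 8 * ‖f y - T x (6 * s x)‖ ^ 4 + 128 * lam ^ 4
          linarith
        rw [integral_add ((hI _ 4 x _).const_mul 8) (integrableOn_const measure_ball_lt_top.ne),
          integral_const_mul, setIntegral_const, smul_eq_mul] at hle
        have h7 := hA x (6 * s x) (by positivity)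
        rw [measureReal_ball_mul x x (by norm_num)] at hle h7
        linarith
      calc _ ≤ _ := hnear
        _ ≤ (8 * A + 128 * lam ^ 4) * 6 ^ Module.finrank ℝ E *
            (4 / lam ^ 2 * ∫ y in ball x (s x), ‖f y - a‖ ^ 2 ∂μ) := by gcongr
        _ = _ := by rw [hq]; ring
  have hdouble : ∫ x in ball z (2 * r), ‖f x - a‖ ^ 2 ∂μ
      ≤ 4 * σ ^ 2 * (2 ^ Module.finrank ℝ E * μ.real (ball z r)) := by
    have hc := norm_sub_sq_le_of_ball_subset hf hκ.le hT (x := z) (z := z) (r := 2 * r) hr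
      (by norm_num : (1 : ℝ) ≤ 6) (by linarith) (ball_subset_ball (by linarith))
    rw [← measureReal_ball_mul z z (by norm_num)]
    have hle : ∫ y in ball z (2 * r), ‖f y - a‖ ^ 2 ∂μ ≤
        ∫ y in ball z (2 * r), (2 * ‖f y - T z (2 * r)‖ ^ 2 + 2 * σ ^ 2) ∂μ := by
      refine integral_mono (hI a 2 z _)
        (((hI _ 2 z _).const_mul 2).add (integrableOn_const measure_ball_lt_top.ne)) fun y => ?_
      have h5 := norm_sub_sq_le_two_mul (f y) a (T z (2 * r))
      rw [norm_sub_rev _ (f y), norm_sub_rev (T z (2 * r)) a] at h5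
      show ‖f y - a‖ ^ 2 ≤ 2 * ‖f y - T z (2 * r)‖ ^ 2 + 2 * σ ^ 2
      linarith
    rw [integral_add ((hI _ 2 z _).const_mul 2) (integrableOn_const measure_ball_lt_top.ne),
      integral_const_mul, setIntegral_const, smul_eq_mul] at hle
    have h7 := hT z (2 * r) (by positivity)
    nlinarith [measureReal_nonneg (μ := μ) (s := ball z (2 * r))]
  have hsmall : ∫ x in ball z r \ X, ‖f x - a‖ ^ 4 ∂μ ≤ 16 * lam ^ 4 * μ.real (ball z r) := by
    calc ∫ x in ball z r \ X, ‖f x - a‖ ^ 4 ∂μ ≤ ∫ _x in ball z r \ X, 16 * lam ^ 4 ∂μ := by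
          refine setIntegral_mono_on ((hI a 4 z r).mono_set sdiff_subset)
            ((integrableOn_const measure_ball_lt_top.ne).mono_set sdiff_subset)
            (measurableSet_ball.diff hXm) fun x hx => ?_
          have : ‖f x - a‖ ≤ 2 * lam := not_lt.1 fun h => hx.2 ⟨hx.1, h⟩
          calc ‖f x - a‖ ^ 4 ≤ (2 * lam) ^ 4 := by gcongr
            _ = _ := by ring
      _ ≤ ∫ _x in ball z r, 16 * lam ^ 4 ∂μ :=
          setIntegral_mono_set (integrableOn_const measure_ball_lt_top.ne)
            (ae_of_all _ fun _ => by positivity) sdiff_subset.eventuallyLE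
      _ = _ := by rw [setIntegral_const, smul_eq_mul, mul_comm]
  have hsplit : ∫ x in ball z r, ‖f x - a‖ ^ 4 ∂μ
      = ∫ x in X, ‖f x - a‖ ^ 4 ∂μ + ∫ x in ball z r \ X, ‖f x - a‖ ^ 4 ∂μ := by
    rw [← setIntegral_union disjoint_sdiff_right (measurableSet_ball.diff hXm)
      ((hI a 4 z r).mono_set hXsub) ((hI a 4 z r).mono_set sdiff_subset),
      union_sdiff_cancel hXsub]
  have hV := measureReal_nonneg (μ := μ) (s := ball z r)
  -- The lower bound on `lam ^ 2` is exactly what makes the last factor in `e` at most 1.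
  have hfinal : q * (4 * σ ^ 2 * (2 ^ Module.finrank ℝ E * μ.real (ball z r)))
      ≤ (A / 2 + 8 * lam ^ 4) * μ.real (ball z r) := by
    have e : q * (4 * σ ^ 2 * (2 ^ Module.finrank ℝ E * μ.real (ball z r)))
        = (A / 2 + 8 * lam ^ 4) * μ.real (ball z r) *
          ((256 * 12 ^ Module.finrank ℝ E * σ ^ 2) / lam ^ 2) := by
      rw [hq, show (12 : ℝ) = 6 * 2 by norm_num, mul_pow]; ring
    rw [e]
    refine mul_le_of_le_one_right (by positivity) ((div_le_one (by positivity)).2 hlam)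
  calc _ = _ := hsplit
    _ ≤ q * (4 * σ ^ 2 * (2 ^ Module.finrank ℝ E * μ.real (ball z r)))
        + 16 * lam ^ 4 * μ.real (ball z r) :=
      add_le_add (hbig.trans (by gcongr)) hsmall
    _ ≤ _ := by linarith

/-- A John-Nirenberg type estimate: for bounded continuous functions, mean-square oscillation
bounds on all balls improve to fourth-power bounds. -/
theorem exists_setIntegral_pow_four_le (μ : Measure E) [μ.IsAddHaarMeasure] :
    ∃ C : ℝ, 0 < C ∧ ∀ (f : E → F) (T : E → ℝ → F) (κ b : ℝ), Continuous f → 0 < κ →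
      (∀ x z r, ‖f x - T z r‖ ≤ b) →
      (∀ z r, 0 < r → ∫ x in ball z r, ‖f x - T z r‖ ^ 2 ∂μ ≤ κ * μ.real (ball z r)) →
      ∀ z r, 0 < r →
        ∫ x in ball z r, ‖f x - T z r‖ ^ 4 ∂μ ≤ C * κ ^ 2 * μ.real (ball z r) := by
  set m : ℝ := 2 * (1 + 6 ^ Module.finrank ℝ E)
  set K : ℝ := 256 * 12 ^ Module.finrank ℝ E
  have hm : 0 < m := by positivity
  have hK : 0 < K := by positivity
  refine ⟨48 * (K * m) ^ 2, by positivity, fun f T κ b hf hκ hb hT z r hr => ?_⟩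
  set σ := Real.sqrt (m * κ)
  have hσ : σ ^ 2 = m * κ := Real.sq_sqrt (by positivity)
  set lam := Real.sqrt (K * σ ^ 2)
  have hσ2 : 0 < σ ^ 2 := by rw [hσ]; positivity
  have hlam : lam ^ 2 = K * σ ^ 2 := Real.sq_sqrt (by positivity)
  have hlam0 : 0 < lam := Real.sqrt_pos.2 (by positivity)
  -- `48 * lam ^ 4` is the fixed point of `A ↦ A / 2 + 24 * lam ^ 4`; the excess `b ^ 4` halves at
  -- each step.
  have hiter : ∀ n : ℕ, ∀ z r, 0 < r → ∫ x in ball z r, ‖f x - T z r‖ ^ 4 ∂μ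
      ≤ (b ^ 4 * (1 / 2) ^ n + 48 * lam ^ 4) * μ.real (ball z r) := by
    intro n
    induction n with
    | zero =>
      intro z r hr
      calc ∫ x in ball z r, ‖f x - T z r‖ ^ 4 ∂μ ≤ ∫ _x in ball z r, b ^ 4 ∂μ :=
            integral_mono ((hf.norm_sub_const_pow _ 4).integrableOn_ball z r)
              (integrableOn_const measure_ball_lt_top.ne)
              fun x => pow_le_pow_left₀ (norm_nonneg _) (hb x z r) 4
        _ = b ^ 4 * μ.real (ball z r) := by rw [setIntegral_const, smul_eq_mul, mul_comm]
        _ ≤ _ := by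
          gcongr
          have : 0 ≤ lam ^ 4 := by positivity
          linarith
    | succ n ih =>
      intro z r hr
      refine (setIntegral_pow_four_improvement hf hκ hT (Real.sqrt_nonneg _) hσ.ge hlam.ge hlam0
        (by positivity) ih z hr).trans_eq ?_
      ring
  have hlim : Tendsto (fun n : ℕ => (b ^ 4 * (1 / 2 : ℝ) ^ n + 48 * lam ^ 4) * μ.real (ball z r))
      atTop (𝓝 ((b ^ 4 * 0 + 48 * lam ^ 4) * μ.real (ball z r))) :=
    (((tendsto_pow_atTop_nhds_zero_of_lt_one (by norm_num) (by norm_num)).const_mul _).add_const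
      _).mul_const _
  refine (ge_of_tendsto' hlim fun n => hiter n z r hr).trans_eq ?_
  rw [show lam ^ 4 = (lam ^ 2) ^ 2 by ring, hlam, hσ]
  ring

end Oscillation

/-! ### Near isometries and their difference quotients. -/

section NearIsometry

open Metric Set Filter Topology
open scoped RealInnerProductSpace

variable {E : Type*} [NormedAddCommGroup E] [InnerProductSpace ℝ E] {Φ : E → E} {ε : ℝ}

/-- Polarization reduces inner products to distances, which `Φ` almost preserves. -/
lemma two_mul_inner_sub_sub (a b c d : E) :
    2 * ⟪a - b, c - d⟫ = ‖a - d‖ ^ 2 + ‖b - c‖ ^ 2 - ‖a - c‖ ^ 2 - ‖b - d‖ ^ 2 := by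
  simp only [norm_sub_sq_real, inner_sub_left, inner_sub_right]
  ring

/-- Almost isometric maps almost preserve inner products of difference vectors. -/
lemma inner_sub_sub_ge_of_almost_isometry
    (hd : ∀ x y, |‖Φ x - Φ y‖ ^ 2 - ‖x - y‖ ^ 2| ≤ ε * ‖x - y‖ ^ 2) (a b c d : E) :
    2 * ⟪a - b, c - d⟫ -
      ε * (‖a - d‖ ^ 2 + ‖b - c‖ ^ 2 + ‖a - c‖ ^ 2 + ‖b - d‖ ^ 2)
      ≤ 2 * ⟪Φ a - Φ b, Φ c - Φ d⟫ := by
  rw [two_mul_inner_sub_sub, two_mul_inner_sub_sub]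
  have h1 := (abs_le.1 (hd a d)).1
  have h2 := (abs_le.1 (hd b c)).1
  have h3 := (abs_le.1 (hd a c)).2
  have h4 := (abs_le.1 (hd b d)).2
  linarith

/-- On a segment in direction `e`, the derivative in direction `e` of an almost isometric map
is close in mean square to the difference quotient along any nearby parallel segment. -/
lemma intervalIntegral_norm_fderiv_sub_sq_le (hΦ : ContDiff ℝ 1 Φ) (hε : 0 ≤ ε)
    (hup : ∀ x v, ‖fderiv ℝ Φ x v‖ ^ 2 ≤ (1 + ε) * ‖v‖ ^ 2)
    (hd : ∀ x y, |‖Φ x - Φ y‖ ^ 2 - ‖x - y‖ ^ 2| ≤ ε * ‖x - y‖ ^ 2)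
    {e : E} (he : ‖e‖ = 1) {x z : E} {r : ℝ} (hr : 0 < r) (hx : ‖x - z‖ ≤ 2 * r) :
    ∫ s in (0 : ℝ)..r, ‖fderiv ℝ Φ (x + s • e) e - r⁻¹ • (Φ (z + r • e) - Φ z)‖ ^ 2
      ≤ 28 * ε * r := by
  set a : E := r⁻¹ • (Φ (z + r • e) - Φ z) with ha
  have hre : ‖r • e‖ = r := by rw [norm_smul, he, mul_one, Real.norm_of_nonneg hr.le]
  have hcont : Continuous fun s : ℝ => fderiv ℝ Φ (x + s • e) e := by
    have := hΦ.continuous_fderiv one_ne_zero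
    fun_prop
  have ha2 : ‖a‖ ^ 2 ≤ 1 + ε := by
    have h1 := (abs_le.1 (hd (z + r • e) z)).2
    rw [add_sub_cancel_left, hre] at h1
    rw [ha, norm_smul, mul_pow, norm_inv, Real.norm_of_nonneg hr.le, inv_pow, inv_mul_le_iff₀
      (by positivity)]
    linarith
  -- The four squared distances are at most `9 + 9 + 4 + 4 = 26` times `r ^ 2`, and half of this
  -- gives 13.
  have hinner : r * (1 - 13 * ε) ≤ ⟪Φ (x + r • e) - Φ x, a⟫ := by
    have h1 := inner_sub_sub_ge_of_almost_isometry hd (x + r • e) x (z + r • e) z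
    rw [add_sub_cancel_left, add_sub_cancel_left, add_sub_add_right_eq_sub,
      real_inner_self_eq_norm_sq, hre] at h1
    have n1 : ‖x + r • e - z‖ ≤ 3 * r := by
      rw [show x + r • e - z = (x - z) + r • e by abel]
      linarith [norm_add_le (x - z) (r • e)]
    have n2 : ‖x - (z + r • e)‖ ≤ 3 * r := by
      rw [show x - (z + r • e) = (x - z) - r • e by abel]
      linarith [norm_sub_le (x - z) (r • e)]
    have m1 : ‖x + r • e - z‖ ^ 2 ≤ (3 * r) ^ 2 := by gcongr
    have m2 : ‖x - (z + r • e)‖ ^ 2 ≤ (3 * r) ^ 2 := by gcongr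
    have m3 : ‖x - z‖ ^ 2 ≤ (2 * r) ^ 2 := by gcongr
    have m4 : ε * (‖x + r • e - z‖ ^ 2 + ‖x - (z + r • e)‖ ^ 2 + ‖x - z‖ ^ 2 + ‖x - z‖ ^ 2)
        ≤ ε * (26 * r ^ 2) := by gcongr; linarith
    rw [ha, real_inner_smul_right, ← div_eq_inv_mul, le_div_iff₀ hr]
    linarith
  have hftc : ∫ s in (0 : ℝ)..r, ⟪fderiv ℝ Φ (x + s • e) e, a⟫ = ⟪Φ (x + r • e) - Φ x, a⟫ := by
    rw [intervalIntegral.integral_eq_sub_of_hasDerivAt (f := fun s : ℝ => ⟪Φ (x + s • e), a⟫)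
      (fun s _ => ?_) ((hcont.inner continuous_const).intervalIntegrable _ _)]
    · simp [inner_sub_left]
    · have hline : HasDerivAt (fun s : ℝ => x + s • e) e s := by
        simpa using ((hasDerivAt_id s).smul_const e).const_add x
      have hcomp := ((hΦ.differentiable one_ne_zero) (x + s • e)).hasFDerivAt.comp_hasDerivAt s
        hline
      simpa using hcomp.inner ℝ (hasDerivAt_const s a)
  have hmono : ∫ s in (0 : ℝ)..r, ‖fderiv ℝ Φ (x + s • e) e - a‖ ^ 2
      ≤ ∫ s in (0 : ℝ)..r, (2 * (1 + ε) - 2 * ⟪fderiv ℝ Φ (x + s • e) e, a⟫) := by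
    refine intervalIntegral.integral_mono_on hr.le
      ((hcont.norm_sub_const_pow a 2).intervalIntegrable _ _)
      ((continuous_const.sub (continuous_const.mul
        (hcont.inner continuous_const))).intervalIntegrable _ _) fun s _ => ?_
    have := hup (x + s • e) e
    rw [he] at this
    rw [norm_sub_sq_real]
    linarith
  rw [intervalIntegral.integral_sub (continuous_const.intervalIntegrable _ _)
    ((continuous_const.mul (hcont.inner continuous_const)).intervalIntegrable _ _),
    intervalIntegral.integral_const, intervalIntegral.integral_const_mul, hftc, smul_eq_mul,
    sub_zero] at hmono
  linarith

/-- A `C¹` diffeomorphism whose derivative is almost orthogonal almost preserves distances. -/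
lemma abs_norm_sub_sq_sub_le_of_fderiv {Ψ : E → E} (hΦ : Differentiable ℝ Φ)
    (hΨ : Differentiable ℝ Ψ) (hinv : ∀ x, Ψ (Φ x) = x) (hinv' : ∀ y, Φ (Ψ y) = y) (hε0 : 0 ≤ ε)
    (hε : ε < 1) (hup : ∀ x v, ‖fderiv ℝ Φ x v‖ ^ 2 ≤ (1 + ε) * ‖v‖ ^ 2)
    (hlow : ∀ x v, (1 - ε) * ‖v‖ ^ 2 ≤ ‖fderiv ℝ Φ x v‖ ^ 2) (x y : E) :
    |‖Φ x - Φ y‖ ^ 2 - ‖x - y‖ ^ 2| ≤ ε * ‖x - y‖ ^ 2 := by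
  have hbound : ∀ {G : E → E} {c : ℝ}, Differentiable ℝ G → 0 ≤ c →
      (∀ x v, ‖fderiv ℝ G x v‖ ^ 2 ≤ c * ‖v‖ ^ 2) → ∀ x y, ‖G x - G y‖ ^ 2 ≤ c * ‖x - y‖ ^ 2 := by
    intro G c hG hc h x y
    have h1 : ‖G x - G y‖ ≤ Real.sqrt c * ‖x - y‖ := by
      refine Convex.norm_image_sub_le_of_norm_fderiv_le (𝕜 := ℝ) (s := univ)
        (fun w _ => hG w) (fun w _ => ?_) convex_univ (mem_univ _) (mem_univ _)
      refine ContinuousLinearMap.opNorm_le_bound _ (Real.sqrt_nonneg _) fun v => ?_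
      rw [← abs_of_nonneg (norm_nonneg (fderiv ℝ G w v)),
        ← abs_of_nonneg (by positivity : 0 ≤ Real.sqrt c * ‖v‖), ← sq_le_sq, mul_pow,
        Real.sq_sqrt hc]
      exact h w v
    calc ‖G x - G y‖ ^ 2 ≤ (Real.sqrt c * ‖x - y‖) ^ 2 := by gcongr
      _ = c * ‖x - y‖ ^ 2 := by rw [mul_pow, Real.sq_sqrt hc]
  have hU := hbound hΦ (by linarith) hup x y
  have hε' : 0 < 1 - ε := by linarith
  -- A lower derivative bound does not integrate along segments, so it is turned into an upper bound
  -- for the derivative of the inverse `Ψ`.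
  have hL := hbound hΨ (inv_nonneg.2 hε'.le) (fun w v => by
    rw [← div_eq_inv_mul, le_div_iff₀ hε', mul_comm]
    refine (hlow (Ψ w) _).trans_eq ?_
    have h1 : HasFDerivAt (Φ ∘ Ψ) ((fderiv ℝ Φ (Ψ w)).comp (fderiv ℝ Ψ w)) w :=
      (hΦ _).hasFDerivAt.comp w (hΨ w).hasFDerivAt
    have h2 : Φ ∘ Ψ = id := funext hinv'
    rw [h2] at h1
    have h3 := h1.unique (hasFDerivAt_id w)
    rw [← ContinuousLinearMap.comp_apply, h3, ContinuousLinearMap.id_apply]) (Φ x) (Φ y)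
  rw [hinv, hinv, ← div_eq_inv_mul, le_div_iff₀ hε'] at hL
  rw [abs_le]
  constructor <;> linarith

variable [FiniteDimensional ℝ E] [MeasurableSpace E] [BorelSpace E]
  {μ : Measure E} [μ.IsAddHaarMeasure]

/-- If the integral of `k` over every segment from `x ∈ ball z (2 * r)` to `x + r • e` is small,
then so is its integral over `ball z r`. -/
lemma setIntegral_ball_le_of_intervalIntegral_le {k : E → ℝ} (hk : Continuous k)
    (hk0 : ∀ x, 0 ≤ k x) {e z : E} (he : ‖e‖ = 1) {r M : ℝ} (hr : 0 < r)
    (h : ∀ x ∈ ball z (2 * r), ∫ s in (0 : ℝ)..r, k (x + s • e) ≤ M * r) :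
    ∫ x in ball z r, k x ∂μ ≤ M * (2 ^ Module.finrank ℝ E * μ.real (ball z r)) := by
  have hint : Integrable (Function.uncurry fun (s : ℝ) (x : E) => k (x + s • e))
      ((volume.restrict (uIoc 0 r)).prod (μ.restrict (ball z (2 * r)))) := by
    have := FiniteDimensional.proper ℝ E
    rw [Measure.prod_restrict]
    have hc : Continuous (Function.uncurry fun (s : ℝ) (x : E) => k (x + s • e)) := by
      simp only [Function.uncurry_def]; fun_prop
    refine IntegrableOn.mono_set (hc.continuousOn.integrableOn_compact
      ((isCompact_uIcc (a := 0) (b := r)).prod (isCompact_closedBall z (2 * r)))) ?_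
    exact prod_mono uIoc_subset_uIcc ball_subset_closedBall
  have hcI : ∀ s : ℝ, Continuous fun x : E => k (x + s • e) := fun s => by fun_prop
  have hswap := intervalIntegral_integral_swap hint
  have hupper : ∫ x in ball z (2 * r), (∫ s in (0 : ℝ)..r, k (x + s • e)) ∂μ
      ≤ M * r * μ.real (ball z (2 * r)) := by
    have : ∫ x in ball z (2 * r), (∫ s in (0 : ℝ)..r, k (x + s • e)) ∂μ
        ≤ ∫ _x in ball z (2 * r), M * r ∂μ := by
      refine setIntegral_mono_on (Continuous.integrableOn_ball ?_ z _)
        (integrableOn_const measure_ball_lt_top.ne) measurableSet_ball h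
      exact intervalIntegral.continuous_parametric_intervalIntegral_of_continuous'
        (by simp only [Function.uncurry_def]; fun_prop) 0 r
    rwa [setIntegral_const, smul_eq_mul, mul_comm _ (M * r)] at this
  have hlower : r * ∫ x in ball z r, k x ∂μ
      ≤ ∫ s in (0 : ℝ)..r, ∫ x in ball z (2 * r), k (x + s • e) ∂μ := by
    have : ∫ _s in (0 : ℝ)..r, ∫ x in ball z r, k x ∂μ
        ≤ ∫ s in (0 : ℝ)..r, ∫ x in ball z (2 * r), k (x + s • e) ∂μ := by
      refine intervalIntegral.integral_mono_on hr.le (continuous_const.intervalIntegrable _ _)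
        ?_ fun s hs => ?_
      · rw [intervalIntegrable_iff]
        exact hint.integral_prod_left
      -- Each translate of `ball z r` by at most `r` stays in the doubled ball, hence the factor `2
      -- ^ finrank`.
      · have hpre : (fun x => x + s • e) ⁻¹' ball z r ⊆ ball z (2 * r) := fun x hx => by
          rw [mem_preimage, mem_ball, dist_eq_norm] at hx
          rw [mem_ball, dist_eq_norm, show x - z = (x + s • e - z) - s • e by abel]
          have := norm_sub_le (x + s • e - z) (s • e)
          rw [norm_smul, he, mul_one, Real.norm_of_nonneg hs.1] at this
          linarith [hs.2]
        rw [← (measurePreserving_add_right μ (s • e)).setIntegral_preimage_emb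
          (measurableEmbedding_addRight _) k (ball z r)]
        exact setIntegral_mono_set ((hcI s).integrableOn_ball z _)
          (ae_of_all _ fun x => hk0 _) hpre.eventuallyLE
    rwa [intervalIntegral.integral_const, smul_eq_mul, sub_zero] at this
  rw [← measureReal_ball_mul z z (by norm_num)]
  have : r * ∫ x in ball z r, k x ∂μ ≤ r * (M * μ.real (ball z (2 * r))) := by
    rw [hswap] at hlower
    linarith
  exact le_of_mul_le_mul_left this hr

lemma setIntegral_norm_fderiv_sub_sq_le (hΦ : ContDiff ℝ 1 Φ) (hε : 0 ≤ ε)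
    (hup : ∀ x v, ‖fderiv ℝ Φ x v‖ ^ 2 ≤ (1 + ε) * ‖v‖ ^ 2)
    (hd : ∀ x y, |‖Φ x - Φ y‖ ^ 2 - ‖x - y‖ ^ 2| ≤ ε * ‖x - y‖ ^ 2)
    {e : E} (he : ‖e‖ = 1) (z : E) {r : ℝ} (hr : 0 < r) :
    ∫ x in ball z r, ‖fderiv ℝ Φ x e - r⁻¹ • (Φ (z + r • e) - Φ z)‖ ^ 2 ∂μ
      ≤ 28 * ε * (2 ^ Module.finrank ℝ E * μ.real (ball z r)) := by
  have hcont := hΦ.continuous_fderiv one_ne_zero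
  exact setIntegral_ball_le_of_intervalIntegral_le (by fun_prop) (fun x => by positivity) he hr
    fun x hx => intervalIntegral_norm_fderiv_sub_sq_le hΦ hε hup hd he hr
      (by rw [← dist_eq_norm]; exact (mem_ball.1 hx).le)

end NearIsometry

/-! ### Matrices close to the orthogonal group, and Jacobians. -/

section Matrices

open Metric Set Filter Topology Matrix

variable {D : ℕ}

/-- A matrix, viewed as a vector whose Euclidean norm is the Hilbert-Schmidt norm. -/
noncomputable def matrixVec (M : Matrix (Fin D) (Fin D) ℝ) : EuclideanSpace ℝ (Fin D × Fin D) :=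
  WithLp.toLp 2 fun p => M p.1 p.2

lemma matrixVec_sub (M N : Matrix (Fin D) (Fin D) ℝ) :
    matrixVec (M - N) = matrixVec M - matrixVec N := rfl

lemma norm_matrixVec (M : Matrix (Fin D) (Fin D) ℝ) : ‖matrixVec M‖ = hsNorm M := by
  rw [EuclideanSpace.norm_eq, hsNorm, Fintype.sum_prod_type]
  simp [matrixVec]

lemma hsNorm_sub (M N : Matrix (Fin D) (Fin D) ℝ) :
    hsNorm (M - N) = ‖matrixVec M - matrixVec N‖ := by
  rw [← matrixVec_sub, norm_matrixVec]

lemma hsNorm_sq (M : Matrix (Fin D) (Fin D) ℝ) : hsNorm M ^ 2 = ∑ i, ∑ j, M i j ^ 2 :=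
  Real.sq_sqrt (Finset.sum_nonneg fun _ _ => Finset.sum_nonneg fun _ _ => sq_nonneg _)

lemma hsNorm_sq_eq_trace (M : Matrix (Fin D) (Fin D) ℝ) : hsNorm M ^ 2 = (Mᵀ * M).trace := by
  rw [hsNorm_sq, Finset.sum_comm]
  simp [Matrix.trace, Matrix.mul_apply, sq]

lemma hsNorm_sq_of_mem_orthogonalGroup {T : Matrix (Fin D) (Fin D) ℝ}
    (hT : T ∈ Matrix.orthogonalGroup (Fin D) ℝ) : hsNorm T ^ 2 = D := by
  have h : Tᵀ * T = 1 := (Matrix.mem_orthogonalGroup_iff' (Fin D) ℝ).1 hT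
  rw [hsNorm_sq_eq_trace, h]
  simp

/-- A matrix with `MᵀM` close to the identity is close to an orthogonal matrix. -/
lemma exists_orthogonal_hsNorm_sub_sq_le {ε : ℝ} (hε0 : 0 ≤ ε) (hε : ε < 1)
    {M : Matrix (Fin D) (Fin D) ℝ}
    (hlow : (Mᵀ * M - (1 - ε) • (1 : Matrix (Fin D) (Fin D) ℝ)).PosSemidef)
    (hup : ((1 + ε) • (1 : Matrix (Fin D) (Fin D) ℝ) - Mᵀ * M).PosSemidef) :
    ∃ T ∈ Matrix.orthogonalGroup (Fin D) ℝ, hsNorm (M - T) ^ 2 ≤ D * ε := by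
  have hH : (Mᵀ * M).IsHermitian := by
    simpa using Matrix.isHermitian_conjTranspose_mul_self M
  set l := hH.eigenvalues with hl
  set U : Matrix (Fin D) (Fin D) ℝ := hH.eigenvectorUnitary.1 with hU
  have hUU : Uᵀ * U = 1 :=
    (Matrix.mem_orthogonalGroup_iff' (Fin D) ℝ).1 hH.eigenvectorUnitary.2
  have hUU' : U * Uᵀ = 1 := mul_eq_one_comm.1 hUU
  have hspec : Mᵀ * M = U * diagonal l * Uᵀ := by
    have := hH.spectral_theorem
    rw [Unitary.conjStarAlgAut_apply] at this
    exact this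
  have hquad : ∀ i, ∃ v : Fin D → ℝ, v ⬝ᵥ v = 1 ∧ v ⬝ᵥ ((Mᵀ * M) *ᵥ v) = l i := fun i => by
    refine ⟨hH.eigenvectorBasis i, ?_, ?_⟩
    · have := hH.eigenvectorBasis.orthonormal.1 i
      rw [EuclideanSpace.norm_eq, Real.sqrt_eq_one] at this
      simpa [dotProduct, sq] using this
    · simpa using (hH.eigenvalues_eq i).symm
  have hl1 : ∀ i, 1 - ε ≤ l i := fun i => by
    obtain ⟨v, hv, hvl⟩ := hquad i
    have := hlow.dotProduct_mulVec_nonneg v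
    rw [star_trivial, sub_mulVec, dotProduct_sub, hvl, smul_mulVec, one_mulVec, dotProduct_smul,
      hv, smul_eq_mul] at this
    linarith
  have hl2 : ∀ i, l i ≤ 1 + ε := fun i => by
    obtain ⟨v, hv, hvl⟩ := hquad i
    have := hup.dotProduct_mulVec_nonneg v
    rw [star_trivial, sub_mulVec, dotProduct_sub, hvl, smul_mulVec, one_mulVec, dotProduct_smul,
      hv, smul_eq_mul] at this
    linarith
  have hlpos : ∀ i, 0 < l i := fun i => by linarith [hl1 i]
  have hN : (M * U)ᵀ * (M * U) = diagonal l := by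
    rw [transpose_mul, Matrix.mul_assoc, ← Matrix.mul_assoc Mᵀ, hspec]
    simp only [Matrix.mul_assoc, hUU, Matrix.mul_one]
    rw [← Matrix.mul_assoc, hUU, Matrix.one_mul]
  -- Both the witness and its difference from `M` have this form, so one Gram computation serves
  -- orthogonality and the distance estimate.
  have hgram : ∀ d : Fin D → ℝ, (M * U * diagonal d * Uᵀ)ᵀ * (M * U * diagonal d * Uᵀ)
      = U * diagonal (fun i => l i * d i ^ 2) * Uᵀ := fun d => by
    calc (M * U * diagonal d * Uᵀ)ᵀ * (M * U * diagonal d * Uᵀ)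
        = U * (diagonal d * ((M * U)ᵀ * (M * U)) * diagonal d) * Uᵀ := by
          simp only [transpose_mul, transpose_transpose, diagonal_transpose, Matrix.mul_assoc]
      _ = _ := by
          rw [hN, diagonal_mul_diagonal, diagonal_mul_diagonal]
          congr 3
          ext i
          ring
  -- The orthogonal polar factor `M (MᵀM)^(-1/2)`.
  refine ⟨M * U * diagonal (fun i => (Real.sqrt (l i))⁻¹) * Uᵀ, ?_, ?_⟩
  · rw [Matrix.mem_orthogonalGroup_iff']
    refine (hgram _).trans ?_
    have : (fun i => l i * (Real.sqrt (l i))⁻¹ ^ 2) = 1 := by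
      ext i
      rw [inv_pow, Real.sq_sqrt (hlpos i).le, mul_inv_cancel₀ (hlpos i).ne', Pi.one_apply]
    rw [this, diagonal_one', Matrix.mul_one, hUU']
  · have hsub : M - M * U * diagonal (fun i => (Real.sqrt (l i))⁻¹) * Uᵀ
        = M * U * diagonal (fun i => 1 - (Real.sqrt (l i))⁻¹) * Uᵀ := by
      have : diagonal (fun i => 1 - (Real.sqrt (l i))⁻¹)
          = 1 - diagonal (fun i => (Real.sqrt (l i))⁻¹) := by
        rw [← diagonal_one, diagonal_sub]
      rw [this, Matrix.mul_sub, Matrix.sub_mul, Matrix.mul_one, Matrix.mul_assoc M U Uᵀ, hUU',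
        Matrix.mul_one]
    rw [hsub, hsNorm_sq_eq_trace, hgram, trace_mul_comm, ← Matrix.mul_assoc, hUU, Matrix.one_mul,
      trace_diagonal]
    calc ∑ i, l i * (1 - (Real.sqrt (l i))⁻¹) ^ 2 ≤ ∑ _i : Fin D, ε := by
          refine Finset.sum_le_sum fun i _ => ?_
          have hs := Real.sqrt_pos.2 (hlpos i)
          have hsq := Real.sq_sqrt (hlpos i).le
          have h1 : l i * (1 - (Real.sqrt (l i))⁻¹) ^ 2 = (Real.sqrt (l i) - 1) ^ 2 := by
            nth_rewrite 1 [← hsq]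
            field_simp
          have h2 : (Real.sqrt (l i) - 1) ^ 2 * 1 ≤ (l i - 1) ^ 2 := by
            have : (l i - 1) ^ 2 = (Real.sqrt (l i) - 1) ^ 2 * (Real.sqrt (l i) + 1) ^ 2 := by
              rw [← mul_pow]; congr 1; linear_combination -hsq
            rw [this]
            gcongr
            nlinarith
          have h3 : (l i - 1) ^ 2 ≤ ε ^ 2 :=
            sq_le_sq' (by linarith [hl1 i]) (by linarith [hl2 i])
          nlinarith
      _ = D * ε := by simp

section Jacobian

variable {Φ : EuclideanSpace ℝ (Fin D) → EuclideanSpace ℝ (Fin D)} {ε : ℝ}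

lemma jacobianMatrix_mulVec (x v : EuclideanSpace ℝ (Fin D)) :
    jacobianMatrix Φ x *ᵥ v.ofLp = (fderiv ℝ Φ x v).ofLp := by
  have hv : v = ∑ j, v j • EuclideanSpace.single j (1 : ℝ) := by
    ext i
    simp [Pi.single_apply]
  ext i
  conv_rhs => rw [hv, map_sum]
  simp [jacobianMatrix, mulVec, dotProduct, mul_comm]

lemma norm_fderiv_sq (x v : EuclideanSpace ℝ (Fin D)) :
    ‖fderiv ℝ Φ x v‖ ^ 2
      = v.ofLp ⬝ᵥ (((jacobianMatrix Φ x)ᵀ * jacobianMatrix Φ x) *ᵥ v.ofLp) := by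
  rw [← mulVec_mulVec, dotProduct_mulVec, vecMul_transpose, jacobianMatrix_mulVec,
    EuclideanSpace.norm_sq_eq]
  simp [dotProduct, sq]

lemma hsNorm_jacobianMatrix_sub_sq (x : EuclideanSpace ℝ (Fin D))
    (a : Fin D → EuclideanSpace ℝ (Fin D)) :
    hsNorm (jacobianMatrix Φ x - Matrix.of fun i j => a j i) ^ 2
      = ∑ j, ‖fderiv ℝ Φ x (EuclideanSpace.single j 1) - a j‖ ^ 2 := by
  rw [hsNorm_sq, Finset.sum_comm]
  simp [EuclideanSpace.norm_sq_eq, jacobianMatrix]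

lemma continuous_matrixVec_jacobianMatrix (hΦ : ContDiff ℝ 1 Φ) :
    Continuous fun x => matrixVec (jacobianMatrix Φ x) := by
  have := hΦ.continuous_fderiv one_ne_zero
  refine (PiLp.continuous_toLp 2 _).comp (continuous_pi fun p => ?_)
  simp only [jacobianMatrix, Matrix.of_apply]
  fun_prop

end Jacobian

/-! ### Mean-square oscillation of the Jacobian of a distorted diffeomorphism. -/

section Distorted

variable {ε : ℝ} {Φ : Diffeomorph 𝓘(ℝ, EuclideanSpace ℝ (Fin D)) 𝓘(ℝ, EuclideanSpace ℝ (Fin D))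
      (EuclideanSpace ℝ (Fin D)) (EuclideanSpace ℝ (Fin D)) 1}

lemma IsDistorted.norm_fderiv_sq_le (h : IsDistorted ε Φ) (x v : EuclideanSpace ℝ (Fin D)) :
    ‖fderiv ℝ Φ x v‖ ^ 2 ≤ (1 + ε) * ‖v‖ ^ 2 := by
  have := (h x).2.dotProduct_mulVec_nonneg v.ofLp
  rw [star_trivial, sub_mulVec, dotProduct_sub, ← norm_fderiv_sq, smul_mulVec, one_mulVec,
    dotProduct_smul, smul_eq_mul] at this
  rw [EuclideanSpace.norm_sq_eq v]
  simpa [dotProduct, ← sq] using this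

lemma IsDistorted.le_norm_fderiv_sq (h : IsDistorted ε Φ) (x v : EuclideanSpace ℝ (Fin D)) :
    (1 - ε) * ‖v‖ ^ 2 ≤ ‖fderiv ℝ Φ x v‖ ^ 2 := by
  have := (h x).1.dotProduct_mulVec_nonneg v.ofLp
  rw [star_trivial, sub_mulVec, dotProduct_sub, ← norm_fderiv_sq, smul_mulVec, one_mulVec,
    dotProduct_smul, smul_eq_mul] at this
  rw [EuclideanSpace.norm_sq_eq v]
  simpa [dotProduct, ← sq] using this

/-- A crude uniform bound that starts the fourth-power iteration and settles the case `ε = 1`. -/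
lemma IsDistorted.hsNorm_jacobianMatrix_sub_sq_le (h : IsDistorted ε Φ) (hε : ε ≤ 1)
    (x : EuclideanSpace ℝ (Fin D)) {T : Matrix (Fin D) (Fin D) ℝ}
    (hT : T ∈ Matrix.orthogonalGroup (Fin D) ℝ) :
    hsNorm (jacobianMatrix Φ x - T) ^ 2 ≤ 6 * D := by
  have hJ : hsNorm (jacobianMatrix Φ x) ^ 2 ≤ 2 * D := by
    have h0 := hsNorm_jacobianMatrix_sub_sq (Φ := Φ) x 0
    have hz : (Matrix.of fun i j => (0 : Fin D → EuclideanSpace ℝ (Fin D)) j i) = 0 := by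
      ext; simp
    rw [hz, sub_zero] at h0
    rw [h0]
    calc _ ≤ ∑ _j : Fin D, (2 : ℝ) := Finset.sum_le_sum fun j _ => by
            have := h.norm_fderiv_sq_le x (EuclideanSpace.single j 1)
            simp only [PiLp.norm_single, norm_one] at this
            simp only [Pi.zero_apply, sub_zero]
            linarith
      _ = 2 * D := by simp [mul_comm]
  have h1 := norm_sub_sq_le_two_mul (matrixVec (jacobianMatrix Φ x)) (matrixVec T) 0
  rw [zero_sub, zero_sub, norm_neg, norm_neg, norm_matrixVec, norm_matrixVec,
    hsNorm_sq_of_mem_orthogonalGroup hT, ← hsNorm_sub] at h1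
  linarith

lemma contDiff_of_diffeomorph : ContDiff ℝ 1 Φ := contMDiff_iff_contDiff.1 Φ.contMDiff

lemma IsDistorted.abs_norm_sub_sq_sub_le (h : IsDistorted ε Φ) (hε0 : 0 ≤ ε) (hε : ε < 1)
    (x y : EuclideanSpace ℝ (Fin D)) :
    |‖Φ x - Φ y‖ ^ 2 - ‖x - y‖ ^ 2| ≤ ε * ‖x - y‖ ^ 2 :=
  abs_norm_sub_sq_sub_le_of_fderiv (Ψ := Φ.symm) (contDiff_of_diffeomorph.differentiable one_ne_zero)
    (contDiff_of_diffeomorph.differentiable one_ne_zero) Φ.symm_apply_apply Φ.apply_symm_apply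
    hε0 hε h.norm_fderiv_sq_le h.le_norm_fderiv_sq x y

/-- The mean-square oscillation of the Jacobian of a distorted diffeomorphism about a suitable
orthogonal matrix is of order `ε`. -/
lemma IsDistorted.exists_setIntegral_hsNorm_sq_le (h : IsDistorted ε Φ) (hε0 : 0 < ε)
    (hε : ε ≤ 1) (z : EuclideanSpace ℝ (Fin D)) {r : ℝ} (hr : 0 < r) :
    ∃ T ∈ Matrix.orthogonalGroup (Fin D) ℝ,
      ∫ x in ball z r, hsNorm (jacobianMatrix Φ x - T) ^ 2
        ≤ (168 * 2 ^ D + 6) * D * ε * volume.real (ball z r) := by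
  have hcont := continuous_matrixVec_jacobianMatrix (contDiff_of_diffeomorph (Φ := Φ))
  have hI : ∀ T : Matrix (Fin D) (Fin D) ℝ,
      IntegrableOn (fun x => hsNorm (jacobianMatrix Φ x - T) ^ 2) (ball z r) := fun T => by
    simp only [hsNorm_sub]
    exact (hcont.norm_sub_const_pow _ 2).integrableOn_ball z r
  have hV : 0 < volume.real (ball z r) := measureReal_ball_pos z hr
  have hconst : ∀ {T : Matrix (Fin D) (Fin D) ℝ} {g : EuclideanSpace ℝ (Fin D) → ℝ} {c : ℝ},
      IntegrableOn g (ball z r) → (∀ x, hsNorm (jacobianMatrix Φ x - T) ^ 2 ≤ 2 * g x + c) →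
      ∫ x in ball z r, hsNorm (jacobianMatrix Φ x - T) ^ 2
        ≤ 2 * (∫ x in ball z r, g x) + c * volume.real (ball z r) := by
    intro T g c hg hle
    have := integral_mono (hI T)
      ((hg.const_mul 2).add (integrableOn_const (C := c) measure_ball_lt_top.ne)) hle
    rwa [integral_add' (hg.const_mul 2) (integrableOn_const (C := c) measure_ball_lt_top.ne),
      integral_const_mul, setIntegral_const, smul_eq_mul, mul_comm _ c] at this
  rcases hε.eq_or_lt with rfl | hε1
  -- At `ε = 1` the lower derivative bound is vacuous, but the crude bound `6 * D` already equals `6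
  -- * D * ε`; this is the source of the summand 6 in the constant.
  · refine ⟨1, one_mem _, ?_⟩
    have := hconst (T := 1) (g := 0) (c := 6 * D) integrableOn_zero fun x => by
      simpa using h.hsNorm_jacobianMatrix_sub_sq_le hε x (one_mem _)
    simp only [Pi.zero_apply, integral_zero, mul_zero, zero_add] at this
    have h0 : 0 ≤ 168 * 2 ^ D * D * volume.real (ball z r) := by positivity
    linarith
  · set a : Fin D → EuclideanSpace ℝ (Fin D) := fun j =>
      r⁻¹ • (Φ (z + r • EuclideanSpace.single j 1) - Φ z) with ha
    set A : Matrix (Fin D) (Fin D) ℝ := Matrix.of fun i j => a j i with hA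
    have hp : ∫ x in ball z r, hsNorm (jacobianMatrix Φ x - A) ^ 2
        ≤ 28 * 2 ^ D * D * ε * volume.real (ball z r) := by
      have hfd := (contDiff_of_diffeomorph (Φ := Φ)).continuous_fderiv one_ne_zero
      simp only [hA, hsNorm_jacobianMatrix_sub_sq]
      rw [integral_finsetSum _ fun j _ => Continuous.integrableOn_ball (by fun_prop) z r]
      calc _ ≤ ∑ _j : Fin D, 28 * ε * (2 ^ D * volume.real (ball z r)) :=
            Finset.sum_le_sum fun j _ => by
              have := setIntegral_norm_fderiv_sub_sq_le (μ := volume)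
                (contDiff_of_diffeomorph (Φ := Φ)) hε0.le h.norm_fderiv_sq_le
                (h.abs_norm_sub_sq_sub_le hε0.le hε1) (e := EuclideanSpace.single j 1)
                (by simp) z hr
              rwa [finrank_euclideanSpace_fin] at this
        _ = _ := by
          rw [Finset.sum_const, Finset.card_univ, Fintype.card_fin, nsmul_eq_mul]
          ring
    -- At a point where the deviation is at most its average, the Jacobian links `A` to an
    -- orthogonal matrix.
    obtain ⟨x₀, -, hx₀⟩ := exists_le_setAverage (measure_ball_pos volume z hr).ne'
      measure_ball_lt_top.ne (hI A)
    have hx₀' : hsNorm (jacobianMatrix Φ x₀ - A) ^ 2 ≤ 28 * 2 ^ D * D * ε := by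
      refine hx₀.trans ?_
      rw [setAverage_eq, smul_eq_mul, ← div_eq_inv_mul, div_le_iff₀ hV]
      exact hp
    obtain ⟨T, hT, hJT⟩ := exists_orthogonal_hsNorm_sub_sq_le hε0.le hε1 (h x₀).1 (h x₀).2
    refine ⟨T, hT, ?_⟩
    have hAT : hsNorm (A - T) ^ 2 ≤ 2 * (28 * 2 ^ D * D * ε) + 2 * (D * ε) := by
      have := norm_sub_sq_le_two_mul (matrixVec A) (matrixVec T)
        (matrixVec (jacobianMatrix Φ x₀))
      simp only [← hsNorm_sub] at this
      linarith
    have := hconst (T := T) (c := 2 * (2 * (28 * 2 ^ D * D * ε) + 2 * (D * ε))) (hI A) fun x => by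
      have := norm_sub_sq_le_two_mul (matrixVec (jacobianMatrix Φ x)) (matrixVec T) (matrixVec A)
      rw [norm_sub_rev (matrixVec A)] at this
      simp only [← hsNorm_sub] at this
      linarith
    have h0 : 0 ≤ D * ε * volume.real (ball z r) := by positivity
    linarith

end Distorted

end Matrices

/-! ### The fourth-power estimate. -/

theorem mainTheorem4 (D : ℕ) (hD : 2 ≤ D) :
    ∃ C : ℝ, 0 < C ∧
      ∀ ε : ℝ, 0 < ε → ε ≤ 1 →
      ∀ Φ : Diffeomorph 𝓘(ℝ, EuclideanSpace ℝ (Fin D)) 𝓘(ℝ, EuclideanSpace ℝ (Fin D))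
          (EuclideanSpace ℝ (Fin D)) (EuclideanSpace ℝ (Fin D)) 1,
        IsDistorted ε Φ →
      ∀ (z : EuclideanSpace ℝ (Fin D)) (r : ℝ), 0 < r →
        ∃ T ∈ Matrix.orthogonalGroup (Fin D) ℝ,
          (1 / volume.real (Metric.ball z r) *
            ∫ x in Metric.ball z r, hsNorm (jacobianMatrix Φ x - T) ^ 4) ^ (1 / 4 : ℝ)
            ≤ C * ε ^ (1 / 2 : ℝ) := by
  obtain ⟨C, hC, hmain⟩ := exists_setIntegral_pow_four_le
    (F := EuclideanSpace ℝ (Fin D × Fin D)) (volume : Measure (EuclideanSpace ℝ (Fin D)))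
  have hD0 : (0 : ℝ) < D := by exact_mod_cast (by omega : 0 < D)
  set K : ℝ := (168 * 2 ^ D + 6) * D with hK
  have hK0 : 0 < K := by positivity
  refine ⟨(C * K ^ 2) ^ (1 / 4 : ℝ), by positivity, fun ε hε0 hε Φ h z r hr => ?_⟩
  choose! T hTmem hT using fun (z : EuclideanSpace ℝ (Fin D)) (r : ℝ) (hr : 0 < r) =>
    h.exists_setIntegral_hsNorm_sq_le hε0 hε z hr
  classical
  -- The uniform bound `b` is required for every real `r`, so the identity, which is orthogonal,
  -- serves as default for `r ≤ 0`.
  set S : EuclideanSpace ℝ (Fin D) → ℝ → Matrix (Fin D) (Fin D) ℝ := fun z r =>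
    if 0 < r then T z r else 1 with hS
  have hSpos : ∀ z {r : ℝ}, 0 < r → S z r = T z r := fun z r hr => if_pos hr
  have hSmem : ∀ z r, S z r ∈ Matrix.orthogonalGroup (Fin D) ℝ := fun z r => by
    by_cases hr : 0 < r
    · rw [hSpos z hr]; exact hTmem z r hr
    · rw [hS]; simp only [if_neg hr]; exact one_mem _
  have hfour := hmain (fun x => matrixVec (jacobianMatrix Φ x)) (fun z r => matrixVec (S z r))
    (K * ε) (Real.sqrt (6 * D)) (continuous_matrixVec_jacobianMatrix contDiff_of_diffeomorph)
    (by positivity)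
    (fun x z r => by
      rw [← hsNorm_sub]
      exact Real.le_sqrt_of_sq_le (h.hsNorm_jacobianMatrix_sub_sq_le hε x (hSmem z r)))
    (fun z r hr => by
      simp only [← hsNorm_sub]
      rw [hSpos z hr]
      exact hT z r hr) z r hr
  refine ⟨S z r, hSmem z r, ?_⟩
  simp only [← hsNorm_sub] at hfour
  have hV : 0 < volume.real (Metric.ball z r) := measureReal_ball_pos z hr
  have hle : 1 / volume.real (Metric.ball z r) *
      ∫ x in Metric.ball z r, hsNorm (jacobianMatrix Φ x - S z r) ^ 4 ≤ C * K ^ 2 * ε ^ 2 := by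
    rw [one_div, ← div_eq_inv_mul, div_le_iff₀ hV]
    linarith
  have hnonneg : 0 ≤ 1 / volume.real (Metric.ball z r) *
      ∫ x in Metric.ball z r, hsNorm (jacobianMatrix Φ x - S z r) ^ 4 :=
    mul_nonneg (by positivity) (integral_nonneg fun x => by positivity)
  calc _ ≤ (C * K ^ 2 * ε ^ 2) ^ (1 / 4 : ℝ) := Real.rpow_le_rpow hnonneg hle (by norm_num)
    _ = (C * K ^ 2) ^ (1 / 4 : ℝ) * ε ^ (1 / 2 : ℝ) := by
      rw [Real.mul_rpow (by positivity) (by positivity), ← Real.rpow_natCast ε 2,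
        ← Real.rpow_mul hε0.le]
      norm_num
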